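/- Let $n\ge 2$ be an integer, $k\in\{1,2,3,4\}$ and $\gamma\in(0,\infty)$, and put $\alpha_1=\dots=\alpha_n=\frac{k}{n-1}$. Consider a general (Crump--Mode--Jagers) branching process with Dirichlet weights $(\alpha_1,\dots,\alpha_n)$, that is, each individual has exactly $n$ offspring, born at (random) ages $\sigma_1,\dots,\sigma_n$ of the parent such that $$(e^{-\gamma\sigma_1},\dots,e^{-\gamma\sigma_n})\sim\mathrm{Dirichlet}(\alpha_1,\dots,\alpha_n).$$ Let $\xi=\sum_{i=1}^n\delta_{\sigma_i}$ be the reproduction point process and let $\nu_\gamma(dt)=\mathbf E\,[e^{-\gamma t}\xi(dt)]$. Write $\mu_j=\int_0^\infty s^j\,\nu_\gamma(ds)$ for its moments, $f(w)=\int_{-\infty}^{\infty}e^{ws}\,\nu_\gamma(ds)$, $w\in\mathbb C$, for its Fourier transform, $H=\sum_{m\ge0}\nu_\gamma^{*m}$ for its renewal measure (where $\nu_\gamma^{*0}=\delta_0$), $H(t)=H((-\infty,t])$, and $G(t)=H(t)-\mu_1^{-1}t$. Then the integral defining $f(w)$ converges absolutely, $f$ is analytic, and $f(w)\ne1$, for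 all $w$ with $0<\operatorname{Re}w\le\gamma$. Moreover $\mu_1$ and $\mu_2$ are finite, $\mu_1>0$, $H(t)<\infty$ for every $t\in\mathbb R$, and $$G(t)-\frac{\mu_2}{2\mu_1^2}=O(e^{-\gamma t})\qquad\text{as }t\to\infty.$$ -/

import Mathlib

open MeasureTheory ProbabilityTheory Filter Asymptotics

noncomputable section

namespace DirichletBranching

/-- The Dirichlet distribution with (positive) parameters `α 1, …, α n`: the law of
`(Y 1, …, Y n) / (Y 1 + ⋯ + Y n)`, where the `Y i` are independent and `Y i` is
Gamma distributed with shape `α i` and rate `1`. -/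
def dirichletMeasure {n : ℕ} (α : Fin n → ℝ) : Measure (Fin n → ℝ) :=
  (Measure.pi fun i => gammaMeasure (α i) 1).map fun y i => y i / ∑ j, y j

/-- The reproduction point process `ξ = ∑ i, δ_{σ i}` of a typical individual whose `n` offspring
are born at the ages `σ 1, …, σ n`. -/
def reproduction {Ω : Type*} {n : ℕ} (σ : Fin n → Ω → ℝ) (ω : Ω) : Measure ℝ :=
  ∑ i, Measure.dirac (σ i ω)

/-- The discounted point process `ξ_γ(dt) = e^{-γ t} ξ(dt)`. -/
def discountedReproduction {Ω : Type*} {n : ℕ} (γ : ℝ) (σ : Fin n → Ω → ℝ) (ω : Ω) : Measure ℝ :=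
  (reproduction σ ω).withDensity fun t => ENNReal.ofReal (Real.exp (-γ * t))

/-- The measure `ν_γ(dt) = E ξ_γ(dt)`, i.e. `ν_γ(A) = E[ξ_γ(A)]`. -/
def nuGamma {Ω : Type*} [MeasurableSpace Ω] (P : Measure Ω) {n : ℕ} (γ : ℝ)
    (σ : Fin n → Ω → ℝ) : Measure ℝ :=
  P.bind (discountedReproduction γ σ)

/-- The `k`-th moment `μ_k = ∫ s ^ k F(ds)`. -/
def mu (F : Measure ℝ) (k : ℕ) : ℝ := ∫ s, s ^ k ∂F

/-- The Fourier transform `f(w) = ∫ e^{w s} F(ds)`, for complex `w`. -/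
def fourierTransform (F : Measure ℝ) (w : ℂ) : ℂ := ∫ s, Complex.exp (w * (s : ℂ)) ∂F

/-- The convolution powers `F^{*m}`, with `F^{*0} = δ_0`. -/
def convPow (F : Measure ℝ) : ℕ → Measure ℝ
  | 0 => Measure.dirac 0
  | m + 1 => (convPow F m).conv F

/-- The renewal measure `H = ∑_{m ≥ 0} F^{*m}`. -/
def renewalMeasure (F : Measure ℝ) : Measure ℝ := Measure.sum fun m => convPow F m

/-- The error `G(t) = H(t) - t / μ_1` in the linear approximation of the renewal function
`H(t) = H((-∞, t])`. -/
def renewalError (F : Measure ℝ) (t : ℝ) : ℝ :=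
  (renewalMeasure F (Set.Iic t)).toReal - (mu F 1)⁻¹ * t

end DirichletBranching

end

/-! Write `a = k/(n-1)`, so that `n a = a + k`. The Dirichlet moments express the Laplace transform
of `ν_γ` at `γ x` as a quotient of Gamma functions. Because `n a - a = k` is an integer, this
collapses to `∏_{j<k} (a+1+j)/(a+1+j+x)` (`dirichlet_moment_eq`). Hence `ν_γ` has density a linear
combination of the exponentials `exp (-l j * s)` with `l j = γ (a+1+j)` (`nuGamma_eq_expMixture`).

For such a measure, with Laplace transform `φ`, the renewal problem is explicit. The solutions of `φ
= 1` are the roots `r i` of the polynomial `∏ (l j + x) - ∏ l j`. The renewal measure minus `δ_0`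
has transform `φ/(1-φ) = ∏ l j / ∏ (x - r i)`, and partial fractions turn this into a density `∑
coeff i * exp (r i * t)`. This candidate is not obtained by inverting a transform: it is checked
against the renewal equation (`renewal_equation`), whose solution is unique
(`renewalMeasure_Iic_eq`). The root `0` yields the linear term, the expansion of `1/(1-φ)` at `0`
yields the constant `μ_2/(2 μ_1^2)` (`mu_one_mul_coeff`), and the other roots yield the error.

It remains that every nonzero root has real part below `-γ`. For `k ≤ 4` the rates are symmetric
about their mean, so the roots can be written down. -/

open scoped Topology

namespace DirichletBranching

/-! ### Exponential mixtures and elementary integrals -/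

variable {ι : Type*} [Fintype ι]

/-- A linear combination of decaying exponentials. -/
noncomputable def expSum (c l : ι → ℝ) (s : ℝ) : ℝ := ∑ j, c j * Real.exp (-l j * s)

/-- The measure on `(0, ∞)` whose density is `expSum c l`. -/
noncomputable def expMixture (c l : ι → ℝ) : Measure ℝ :=
  (volume.restrict (Set.Ioi 0)).withDensity fun s => ENNReal.ofReal (expSum c l s)

/-- The mixture `expMixture c l` has Laplace transform `∏ l j / ∏ (l j + x)`, and the zeros of
`∏ (l j + x) - ∏ l j` are simple: one is `0` and the others lie in `re x < -γ`. -/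
structure IsRationalRenewal (γ : ℝ) (c l : ι → ℝ) (r : ι → ℂ) (i₀ : ι) : Prop where
  pos : 0 < γ
  lt_rate : ∀ j, γ < l j
  nonneg : ∀ s, 0 < s → 0 ≤ expSum c l s
  injective : Function.Injective r
  root_zero : r i₀ = 0
  root_re : ∀ i, i ≠ i₀ → (r i).re < -γ
  char : ∀ x : ℂ, ∏ j, ((l j : ℂ) + x) = ∏ j, (l j : ℂ) + ∏ i, (x - r i)
  transform : ∀ x : ℂ, (∀ j, (l j : ℂ) + x ≠ 0) →
    ∑ j, (c j : ℂ) / (l j + x) = (∏ j, (l j : ℂ)) / ∏ j, ((l j : ℂ) + x)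

@[fun_prop]
lemma continuous_expSum (c l : ι → ℝ) : Continuous (expSum c l) := by
  unfold expSum; fun_prop

lemma ofReal_expSum (c l : ι → ℝ) (s : ℝ) :
    (expSum c l s : ℂ) = ∑ j, (c j : ℂ) * Complex.exp (-(l j : ℂ) * s) := by
  simp [expSum]

lemma integral_pow_mul_exp_neg {m : ℕ} {b : ℝ} (hb : 0 < b) :
    ∫ s in Set.Ioi (0 : ℝ), s ^ m * Real.exp (-b * s) = m.factorial / b ^ (m + 1) := by
  have h := Real.integral_rpow_mul_exp_neg_mul_Ioi (a := (m : ℝ) + 1) (r := b) (by positivity) hb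
  rw [Real.Gamma_nat_eq_factorial] at h
  have e : (1 / b) ^ ((m : ℝ) + 1) = 1 / b ^ (m + 1) := by
    rw [← Nat.cast_succ, Real.rpow_natCast, one_div_pow]
  rw [e] at h
  rw [div_eq_mul_one_div, mul_comm, ← h]
  refine setIntegral_congr_fun measurableSet_Ioi fun s _ => ?_
  simp [Real.rpow_natCast]

lemma integrableOn_pow_mul_exp_neg {m : ℕ} {b : ℝ} (hb : 0 < b) :
    IntegrableOn (fun s : ℝ => s ^ m * Real.exp (-b * s)) (Set.Ioi 0) := by
  -- A non-integrable function has Bochner integral `0`, but this integral is known to be positive.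
  by_contra h
  have h1 := integral_pow_mul_exp_neg (m := m) hb
  rw [integral_undef h] at h1
  have : (0 : ℝ) < m.factorial / b ^ (m + 1) := by positivity
  exact this.ne h1

/-- `∫ x in 0..t, exp (z x)`. -/
noncomputable def expInt (z : ℂ) (t : ℝ) : ℂ := if z = 0 then t else (Complex.exp (z * t) - 1) / z

@[simp]
lemma expInt_zero (z : ℂ) : expInt z 0 = 0 := by simp [expInt]

/-- This form also holds at `z = 0`, so the root `0` needs no separate treatment in the convolution
identities. -/
lemma one_add_mul_expInt (z : ℂ) (t : ℝ) : 1 + z * expInt z t = Complex.exp (z * t) := by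
  unfold expInt
  split_ifs with h
  · simp [h]
  · field_simp; ring

lemma hasDerivAt_expInt (z : ℂ) (t : ℝ) : HasDerivAt (expInt z) (Complex.exp (z * t)) t := by
  by_cases h : z = 0
  · have : expInt z = fun t : ℝ => (t : ℂ) := by ext t; simp [expInt, h]
    rw [this, h]
    simpa using (hasDerivAt_id t).ofReal_comp
  · have : expInt z = fun t : ℝ => (Complex.exp (z * t) - 1) / z := by ext t; simp [expInt, h]
    rw [this]
    have h1 : HasDerivAt (fun t : ℝ => z * (t : ℂ)) z t := by
      simpa using ((hasDerivAt_id t).ofReal_comp).const_mul z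
    refine ((h1.cexp.sub_const 1).div_const z).congr_deriv ?_
    field_simp

@[fun_prop]
lemma continuous_expInt (z : ℂ) : Continuous (expInt z) :=
  continuous_iff_continuousAt.2 fun t => (hasDerivAt_expInt z t).continuousAt

lemma integral_exp_neg_eq_expInt (b : ℂ) (t : ℝ) :
    ∫ y in (0 : ℝ)..t, Complex.exp (-b * y) = expInt (-b) t := by
  rw [intervalIntegral.integral_eq_sub_of_hasDerivAt (fun y _ => hasDerivAt_expInt (-b) y)
    (Continuous.intervalIntegrable (by fun_prop) _ _)]
  simp

/-- In Laplace transforms this is `1/((p-z)(p+b)) = (1/(p-z) - 1/(p+b))/(b+z)`, up to the factor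
`1/p`; the proof exhibits an antiderivative. -/
lemma integral_expInt_mul_exp {z b : ℂ} (h : b + z ≠ 0) (t : ℝ) :
    ∫ y in (0 : ℝ)..t, expInt z (t - y) * Complex.exp (-b * y) =
      (expInt z t - expInt (-b) t) / (b + z) := by
  have key : ∀ y : ℝ, HasDerivAt
      (fun y : ℝ => -(expInt z (t - y) * Complex.exp (-b * y) + expInt (-b) y) / (b + z))
      (expInt z (t - y) * Complex.exp (-b * y)) y := by
    intro y
    have h0 : HasDerivAt (fun y : ℝ => t - y) (-1) y := by
      simpa using (hasDerivAt_id y).const_sub t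
    have h1 := (hasDerivAt_expInt z (t - y)).scomp y h0
    have h2 : HasDerivAt (fun t : ℝ => -b * (t : ℂ)) (-b) y := by
      simpa using ((hasDerivAt_id y).ofReal_comp).const_mul (-b)
    refine (((h1.mul h2.cexp).add (hasDerivAt_expInt (-b) y)).neg.div_const
      (b + z)).congr_deriv ?_
    have h3 := one_add_mul_expInt z (t - y)
    rw [div_eq_iff h, ← h3]
    simp only [Function.comp_apply, neg_smul, one_smul]
    ring
  rw [intervalIntegral.integral_eq_sub_of_hasDerivAt (fun y _ => key y)
    (Continuous.intervalIntegrable (by fun_prop) _ _)]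
  simp
  ring

namespace IsRationalRenewal

variable {γ : ℝ} {c l : ι → ℝ} {r : ι → ℂ} {i₀ : ι}

lemma rate_pos (h : IsRationalRenewal γ c l r i₀) (j : ι) : 0 < l j := h.pos.trans (h.lt_rate j)

lemma prod_rate_ne_zero (h : IsRationalRenewal γ c l r i₀) : (∏ j, (l j : ℂ)) ≠ 0 :=
  Finset.prod_ne_zero_iff.2 fun j _ => Complex.ofReal_ne_zero.2 (h.rate_pos j).ne'

lemma rate_add_ne_zero (h : IsRationalRenewal γ c l r i₀) {x : ℂ} {j : ι} (hx : -γ ≤ x.re) :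
    (l j : ℂ) + x ≠ 0 := by
  intro e
  have := congrArg Complex.re e
  simp at this
  linarith [h.lt_rate j]

lemma prod_sub_root (r : ι → ℂ) (i : ι) : ∏ j, (r i - r j) = 0 :=
  Finset.prod_eq_zero (Finset.mem_univ i) (sub_self _)

/-- At a root the product of all these factors equals `∏ l j ≠ 0`. -/
lemma rate_add_root_ne_zero (h : IsRationalRenewal γ c l r i₀) (i j : ι) :
    (l j : ℂ) + r i ≠ 0 := by
  intro e
  have h1 := h.char (r i)
  rw [Finset.prod_eq_zero (Finset.mem_univ j) e, prod_sub_root, add_zero] at h1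
  exact h.prod_rate_ne_zero h1.symm

lemma transform_root (h : IsRationalRenewal γ c l r i₀) (i : ι) :
    ∑ j, (c j : ℂ) / (l j + r i) = 1 := by
  rw [h.transform _ (h.rate_add_root_ne_zero i), h.char, prod_sub_root, add_zero, div_self h.prod_rate_ne_zero]

/-! ### Partial fractions and the candidate renewal function -/

variable [DecidableEq ι]

/-- The coefficients of the renewal density `∑ i, coeff i * exp (r i * t)`. -/
noncomputable def coeff (l : ι → ℝ) (r : ι → ℂ) (i : ι) : ℂ :=
  (∏ j, (l j : ℂ)) * Lagrange.nodalWeight Finset.univ r i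

/-- Partial fractions of `φ/(1-φ)`, read off from Lagrange interpolation of the constant `1` at the
nodes `r i`. -/
lemma sum_coeff_div (h : IsRationalRenewal γ c l r i₀) {x : ℂ} (hx : ∀ i, x ≠ r i) :
    ∑ i, coeff l r i / (x - r i) = (∏ j, (l j : ℂ)) / ∏ i, (x - r i) := by
  have h1 := Lagrange.eval_interpolate_not_at_node (s := Finset.univ) (v := r) 1
    (fun i _ => hx i)
  rw [Lagrange.interpolate_one h.injective.injOn ⟨i₀, Finset.mem_univ _⟩, Polynomial.eval_one,
    Lagrange.eval_nodal] at h1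
  have h2 : ∏ i, (x - r i) ≠ 0 := Finset.prod_ne_zero_iff.2 fun i _ => sub_ne_zero.2 (hx i)
  rw [eq_div_iff h2]
  calc _ = (∏ j, (l j : ℂ)) * ((∏ i, (x - r i)) * ∑ i, Lagrange.nodalWeight Finset.univ r i *
      (x - r i)⁻¹ * (1 : ι → ℂ) i) := by
        simp only [coeff, Pi.one_apply, mul_one, div_eq_mul_inv, mul_assoc, ← Finset.mul_sum]
        ring
    _ = _ := by rw [← h1, mul_one]

/-- The partial fractions at `x = -l j`, where `char` gives `∏ (x - r i) = -∏ l j`. -/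
lemma sum_coeff_div_rate (h : IsRationalRenewal γ c l r i₀) (j : ι) :
    ∑ i, coeff l r i / (l j + r i) = 1 := by
  have h1 : ∀ i, -(l j : ℂ) ≠ r i := fun i e => h.rate_add_root_ne_zero i j (by rw [← e]; ring)
  have h2 := h.sum_coeff_div h1
  have h3 := h.char (-(l j : ℂ))
  rw [Finset.prod_eq_zero (Finset.mem_univ j) (by ring)] at h3
  rw [← neg_eq_of_add_eq_zero_right h3.symm, div_neg, div_self h.prod_rate_ne_zero] at h2
  rw [← neg_inj, ← h2, ← Finset.sum_neg_distrib]
  refine Finset.sum_congr rfl fun i _ => ?_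
  rw [← div_neg]; congr 1; ring

/-- The renewal function. -/
noncomputable def renewalFun (l : ι → ℝ) (r : ι → ℂ) (t : ℝ) : ℂ :=
  if 0 ≤ t then 1 + ∑ i, coeff l r i * expInt (r i) t else 0

/-- Two cancellations: `sum_coeff_div_rate` removes the terms with exponent `-l j`, and
`transform_root` gives each `expInt (r i) t` back its coefficient. -/
lemma intervalIntegral_renewal (h : IsRationalRenewal γ c l r i₀) (t : ℝ) :
    ∫ y in (0 : ℝ)..t, (1 + ∑ i, coeff l r i * expInt (r i) (t - y)) * (expSum c l y : ℂ) =
      ∑ i, coeff l r i * expInt (r i) t := by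
  have e : ∀ y : ℝ, (1 + ∑ i, coeff l r i * expInt (r i) (t - y)) * (expSum c l y : ℂ) =
      ∑ j, (c j * Complex.exp (-(l j : ℂ) * y) + ∑ i, coeff l r i * c j *
        (expInt (r i) (t - y) * Complex.exp (-(l j : ℂ) * y))) := by
    intro y
    rw [ofReal_expSum, Finset.mul_sum]
    refine Finset.sum_congr rfl fun j _ => ?_
    rw [add_mul, one_mul, Finset.sum_mul]
    congr 1
    refine Finset.sum_congr rfl fun i _ => ?_
    ring
  simp only [e]
  rw [intervalIntegral.integral_finsetSum
    (fun j _ => Continuous.intervalIntegrable (by fun_prop) _ _)]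
  have e2 : ∀ j, ∫ y in (0 : ℝ)..t, (c j * Complex.exp (-(l j : ℂ) * y) + ∑ i, coeff l r i * c j *
        (expInt (r i) (t - y) * Complex.exp (-(l j : ℂ) * y))) =
      ∑ i, coeff l r i * c j * expInt (r i) t / (l j + r i) := by
    intro j
    rw [intervalIntegral.integral_add (Continuous.intervalIntegrable (by fun_prop) _ _)
      (Continuous.intervalIntegrable (by fun_prop) _ _), intervalIntegral.integral_finsetSum
      (fun j _ => Continuous.intervalIntegrable (by fun_prop) _ _),
      intervalIntegral.integral_const_mul, integral_exp_neg_eq_expInt]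
    simp only [intervalIntegral.integral_const_mul,
      integral_expInt_mul_exp (h.rate_add_root_ne_zero _ j)]
    have h1 : (c j : ℂ) * expInt (-(l j : ℂ)) t =
        ∑ i, coeff l r i / (l j + r i) * (c j * expInt (-(l j : ℂ)) t) := by
      rw [← Finset.sum_mul, h.sum_coeff_div_rate, one_mul]
    rw [h1, ← Finset.sum_add_distrib]
    refine Finset.sum_congr rfl fun i _ => ?_
    ring
  simp only [e2]
  rw [Finset.sum_comm]
  refine Finset.sum_congr rfl fun i _ => ?_
  calc _ = coeff l r i * expInt (r i) t * ∑ j, (c j : ℂ) / (l j + r i) := by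
        rw [Finset.mul_sum]; exact Finset.sum_congr rfl fun j _ => by ring
    _ = _ := by rw [h.transform_root, mul_one]

end IsRationalRenewal
-- Moments, Fourier transform and renewal equation of a mixture
lemma ae_expMixture_pos (c l : ι → ℝ) : ∀ᵐ s ∂(expMixture c l), 0 < s :=
  (withDensity_absolutelyContinuous _ _).ae_le (ae_restrict_mem measurableSet_Ioi)

namespace IsRationalRenewal

variable {γ : ℝ} {c l : ι → ℝ} {r : ι → ℂ} {i₀ : ι}

lemma integrable_expMixture_iff (h : IsRationalRenewal γ c l r i₀) {E : Type*}
    [NormedAddCommGroup E] [NormedSpace ℝ E] {f : ℝ → E} :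
    Integrable f (expMixture c l) ↔ IntegrableOn (fun s => expSum c l s • f s) (Set.Ioi 0) := by
  rw [expMixture, integrable_withDensity_iff_integrable_smul' (by fun_prop) (by simp)]
  refine integrableOn_congr_fun (fun s hs => ?_) measurableSet_Ioi
  simp only [ENNReal.toReal_ofReal (h.nonneg s hs)]

lemma integral_expMixture (h : IsRationalRenewal γ c l r i₀) {E : Type*}
    [NormedAddCommGroup E] [NormedSpace ℝ E] (f : ℝ → E) :
    ∫ s, f s ∂(expMixture c l) = ∫ s in Set.Ioi 0, expSum c l s • f s := by
  rw [expMixture, integral_withDensity_eq_integral_toReal_smul (by fun_prop) (by simp)]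
  refine setIntegral_congr_fun measurableSet_Ioi fun s hs => ?_
  simp only [ENNReal.toReal_ofReal (h.nonneg s hs)]

lemma expSum_mul_pow (c l : ι → ℝ) (m : ℕ) (s : ℝ) :
    expSum c l s • s ^ m = ∑ j, c j * (s ^ m * Real.exp (-l j * s)) := by
  rw [expSum, smul_eq_mul, Finset.sum_mul]
  exact Finset.sum_congr rfl fun j _ => by ring

lemma integrable_pow (h : IsRationalRenewal γ c l r i₀) (m : ℕ) :
    Integrable (fun s => s ^ m) (expMixture c l) := by
  rw [h.integrable_expMixture_iff]
  simp only [expSum_mul_pow]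
  exact integrable_finsetSum _ fun j _ =>
    (integrableOn_pow_mul_exp_neg (h.rate_pos j)).const_mul _

lemma mu_expMixture (h : IsRationalRenewal γ c l r i₀) (m : ℕ) :
    mu (expMixture c l) m = ∑ j, c j * (m.factorial / l j ^ (m + 1)) := by
  rw [mu, h.integral_expMixture]
  simp only [expSum_mul_pow]
  rw [integral_finsetSum _ fun j _ =>
    (integrableOn_pow_mul_exp_neg (h.rate_pos j)).const_mul _]
  simp only [integral_const_mul, integral_pow_mul_exp_neg (h.rate_pos _)]

lemma mu_nonneg (m : ℕ) : 0 ≤ mu (expMixture c l) m := by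
  refine integral_nonneg_of_ae ?_
  filter_upwards [ae_expMixture_pos c l] with s hs using by positivity

lemma expSum_mul_exp (c l : ι → ℝ) (w : ℂ) (s : ℝ) :
    expSum c l s • Complex.exp (w * s) = ∑ j, (c j : ℂ) * Complex.exp ((w - l j) * s) := by
  rw [Complex.real_smul, ofReal_expSum, Finset.sum_mul]
  refine Finset.sum_congr rfl fun j _ => ?_
  rw [mul_assoc, ← Complex.exp_add]
  congr 2; ring

lemma integrable_exp (h : IsRationalRenewal γ c l r i₀) {w : ℂ} (hw : ∀ j, w.re < l j) :
    Integrable (fun s : ℝ => Complex.exp (w * s)) (expMixture c l) := by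
  rw [h.integrable_expMixture_iff]
  simp only [expSum_mul_exp]
  exact integrable_finsetSum _ fun j _ =>
    (integrableOn_exp_mul_complex_Ioi (by simpa using hw j) 0).const_mul _

lemma fourierTransform_expMixture (h : IsRationalRenewal γ c l r i₀) {w : ℂ}
    (hw : ∀ j, w.re < l j) :
    fourierTransform (expMixture c l) w = ∑ j, (c j : ℂ) / (l j - w) := by
  rw [fourierTransform, h.integral_expMixture]
  simp only [expSum_mul_exp]
  rw [integral_finsetSum _ fun j _ =>
    (integrableOn_exp_mul_complex_Ioi (by simpa using hw j) 0).const_mul _]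
  refine Finset.sum_congr rfl fun j _ => ?_
  rw [integral_const_mul, integral_exp_mul_complex_Ioi (by simpa using hw j)]
  simp only [Complex.ofReal_zero, mul_zero, Complex.exp_zero]
  rw [← neg_sub (l j : ℂ) w, div_neg, neg_div, neg_neg, mul_one_div]

lemma sum_div_eq (h : IsRationalRenewal γ c l r i₀) {w : ℂ} (hw : w.re ≤ γ) :
    ∑ j, (c j : ℂ) / (l j - w) = (∏ j, (l j : ℂ)) / ∏ j, ((l j : ℂ) - w) := by
  have := h.transform (-w) fun j => h.rate_add_ne_zero (by simpa using hw)
  simpa only [← sub_eq_add_neg] using this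

lemma isProbabilityMeasure (h : IsRationalRenewal γ c l r i₀) :
    IsProbabilityMeasure (expMixture c l) := by
  have h1 := h.fourierTransform_expMixture (w := 0) fun j => by simpa using h.rate_pos j
  rw [h.sum_div_eq (by simpa using h.pos.le)] at h1
  simp only [sub_zero, div_self h.prod_rate_ne_zero, fourierTransform, zero_mul,
    Complex.exp_zero, integral_const] at h1
  have h2 : (expMixture c l).real Set.univ = 1 := by simpa using h1
  refine ⟨?_⟩
  rwa [measureReal_def, ENNReal.toReal_eq_one_iff] at h2

lemma analyticOnNhd_fourierTransform (h : IsRationalRenewal γ c l r i₀) :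
    AnalyticOnNhd ℂ (fourierTransform (expMixture c l)) {w : ℂ | 0 < w.re ∧ w.re ≤ γ} := by
  intro w hw
  have h1 : ∀ j, w.re < l j := fun j => hw.2.trans_lt (h.lt_rate j)
  have h2 : AnalyticAt ℂ (fun w : ℂ => ∑ j, (c j : ℂ) / (l j - w)) w := by
    refine Finset.analyticAt_fun_sum _ fun j _ => analyticAt_const.div
      (analyticAt_const.sub analyticAt_id) ?_
    intro e
    have := congrArg Complex.re e
    simp at this
    linarith [h1 j]
  refine h2.congr ?_
  have : ∀ᶠ v : ℂ in 𝓝 w, ∀ j, v.re < l j := eventually_all.2 fun j =>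
    Complex.continuous_re.continuousAt.eventually_lt continuousAt_const (h1 j)
  filter_upwards [this] with v hv using (h.fourierTransform_expMixture hv).symm

/-- If `f w = 1` then `-w` is a root, but no root has real part in `[-γ, 0)`. -/
lemma fourierTransform_ne_one (h : IsRationalRenewal γ c l r i₀) {w : ℂ} (hw : 0 < w.re)
    (hw' : w.re ≤ γ) : fourierTransform (expMixture c l) w ≠ 1 := by
  rw [h.fourierTransform_expMixture fun j => hw'.trans_lt (h.lt_rate j), h.sum_div_eq hw']
  intro e
  have h1 : ∏ j, ((l j : ℂ) - w) ≠ 0 := Finset.prod_ne_zero_iff.2 fun j _ => by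
    rw [sub_eq_add_neg]
    exact h.rate_add_ne_zero (by simpa using hw')
  rw [div_eq_one_iff_eq h1] at e
  have h2 := h.char (-w)
  simp only [← sub_eq_add_neg] at h2
  rw [e, eq_comm, add_eq_left] at h2
  obtain ⟨i, -, hi⟩ := Finset.prod_eq_zero_iff.1 h2
  have h3 := congrArg Complex.re (sub_eq_zero.1 hi)
  rw [Complex.neg_re] at h3
  by_cases hi₀ : i = i₀
  · rw [hi₀, h.root_zero] at h3
    simp at h3; linarith
  · linarith [h.root_re i hi₀]

lemma root_re_nonpos (h : IsRationalRenewal γ c l r i₀) (i : ι) : (r i).re ≤ 0 := by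
  by_cases hi₀ : i = i₀
  · simp [hi₀, h.root_zero]
  · linarith [h.root_re i hi₀, h.pos]

lemma norm_expInt_le {z : ℂ} (hz : z.re ≤ 0) {t : ℝ} (ht : 0 ≤ t) :
    ‖expInt z t‖ ≤ (1 + 2 / ‖z‖) * Real.exp t := by
  have h1 : 1 ≤ Real.exp t := Real.one_le_exp ht
  unfold expInt
  -- At `z = 0` the term `2 / ‖z‖` is `0` by convention, and `t ≤ exp t` suffices.
  split_ifs with h0
  · simp only [h0, norm_zero, div_zero, add_zero, one_mul, Complex.norm_real, Real.norm_eq_abs,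
      abs_of_nonneg ht]
    linarith [Real.add_one_le_exp t]
  · rw [norm_div]
    have h2 : ‖Complex.exp (z * t) - 1‖ ≤ 2 := by
      refine (norm_sub_le _ _).trans ?_
      rw [Complex.norm_exp, norm_one]
      have : Real.exp (z * t).re ≤ 1 := Real.exp_le_one_iff.2 (by
        simpa using mul_nonpos_of_nonpos_of_nonneg hz ht)
      linarith
    calc _ ≤ 2 / ‖z‖ := by gcongr
      _ ≤ 1 + 2 / ‖z‖ := by linarith
      _ ≤ _ := le_mul_of_one_le_right (by positivity) h1

variable [DecidableEq ι]

lemma exists_norm_renewalFun_le (h : IsRationalRenewal γ c l r i₀) :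
    ∃ K, ∀ t, ‖renewalFun l r t‖ ≤ K * Real.exp t := by
  refine ⟨1 + ∑ i, ‖coeff l r i‖ * (1 + 2 / ‖r i‖), fun t => ?_⟩
  unfold renewalFun
  split_ifs with ht
  · refine (norm_add_le _ _).trans ?_
    rw [add_mul, Finset.sum_mul]
    refine add_le_add (by simpa using ht) ((norm_sum_le _ _).trans
      (Finset.sum_le_sum fun i _ => ?_))
    rw [norm_mul, mul_assoc]
    gcongr
    exact norm_expInt_le (h.root_re_nonpos i) ht
  · rw [norm_zero]; positivity

lemma measurable_renewalFun (l : ι → ℝ) (r : ι → ℂ) : Measurable (renewalFun l r) :=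
  Measurable.ite measurableSet_Ici (by fun_prop) measurable_const

lemma renewal_equation (h : IsRationalRenewal γ c l r i₀) (t : ℝ) :
    renewalFun l r t = (Set.Iic t).indicator 1 0 +
      ∫ s, renewalFun l r (t - s) ∂(expMixture c l) := by
  rcases lt_or_ge t 0 with ht | ht
  · rw [Set.indicator_of_notMem (by simpa using ht), zero_add, renewalFun, if_neg ht.not_ge]
    rw [integral_eq_zero_of_ae]
    filter_upwards [ae_expMixture_pos c l] with s hs
    rw [renewalFun, if_neg (by linarith)]; rfl
  · rw [Set.indicator_of_mem (by simpa using ht), renewalFun, if_pos ht,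
      ← h.intervalIntegral_renewal, h.integral_expMixture,
      intervalIntegral.integral_of_le ht]
    congr 1
    rw [setIntegral_eq_of_subset_of_forall_sdiff_eq_zero measurableSet_Ioi
      (Set.Ioc_subset_Ioi_self : Set.Ioc 0 t ⊆ Set.Ioi 0)]
    · refine setIntegral_congr_fun measurableSet_Ioc fun s hs => ?_
      simp only [renewalFun, if_pos (sub_nonneg.2 hs.2), Complex.real_smul]
      ring
    · intro s hs
      have : t < s := by
        by_contra hc
        exact hs.2 ⟨hs.1, not_lt.1 hc⟩
      rw [renewalFun, if_neg (by linarith), smul_zero]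

end IsRationalRenewal
end DirichletBranching

/-! ### Uniqueness for the renewal equation -/

namespace DirichletBranching

instance isProbabilityMeasure_convPow (F : Measure ℝ) [IsProbabilityMeasure F] (m : ℕ) :
    IsProbabilityMeasure (convPow F m) := by
  induction m with
  | zero => exact inferInstanceAs (IsProbabilityMeasure (Measure.dirac 0))
  | succ m ih => exact inferInstanceAs (IsProbabilityMeasure ((convPow F m).conv F))

lemma lintegral_exp_neg_convPow (F : Measure ℝ) [IsProbabilityMeasure F] (m : ℕ) :
    ∫⁻ s, ENNReal.ofReal (Real.exp (-s)) ∂(convPow F m) =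
      (∫⁻ s, ENNReal.ofReal (Real.exp (-s)) ∂F) ^ m := by
  induction m with
  | zero => simp [convPow]
  | succ m ih =>
    rw [convPow, Measure.lintegral_conv (by fun_prop)]
    simp only [neg_add, Real.exp_add, ENNReal.ofReal_mul (Real.exp_nonneg _)]
    simp_rw [lintegral_const_mul _ (show Measurable fun s : ℝ => ENNReal.ofReal (Real.exp (-s))
      by fun_prop)]
    rw [lintegral_mul_const _ (by fun_prop), ih, pow_succ]

/-- Chernoff's bound: `1 ≤ exp (t - s)` for `s ≤ t`. -/
lemma convPow_Iic_le (F : Measure ℝ) [IsProbabilityMeasure F] (m : ℕ) (t : ℝ) :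
    convPow F m (Set.Iic t) ≤ ENNReal.ofReal (Real.exp t) *
      (∫⁻ s, ENNReal.ofReal (Real.exp (-s)) ∂F) ^ m := by
  rw [← lintegral_exp_neg_convPow, ← lintegral_const_mul _ (by fun_prop),
    ← lintegral_indicator_one measurableSet_Iic]
  refine lintegral_mono fun s => ?_
  by_cases hs : s ≤ t
  · rw [Set.indicator_of_mem (by simpa using hs), ← ENNReal.ofReal_mul (Real.exp_nonneg _),
      ← Real.exp_add, Pi.one_apply, ENNReal.one_le_ofReal]
    exact Real.one_le_exp (by linarith)
  · rw [Set.indicator_of_notMem (by simpa using hs)]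
    exact zero_le

lemma renewalMeasure_Iic_lt_top (F : Measure ℝ) [IsProbabilityMeasure F]
    (hF : ∫⁻ s, ENNReal.ofReal (Real.exp (-s)) ∂F < 1) (t : ℝ) :
    renewalMeasure F (Set.Iic t) < ⊤ := by
  rw [renewalMeasure, Measure.sum_apply _ measurableSet_Iic]
  refine (ENNReal.tsum_le_tsum fun m => convPow_Iic_le F m t).trans_lt ?_
  rw [ENNReal.tsum_mul_left, ENNReal.tsum_geometric]
  exact ENNReal.mul_lt_top ENNReal.ofReal_lt_top
    (ENNReal.inv_lt_top.2 (tsub_pos_iff_lt.2 hF))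

/-- A function of at most exponential growth that solves the renewal equation is the renewal
function. -/
theorem renewalMeasure_Iic_eq (F : Measure ℝ) [IsProbabilityMeasure F]
    (hF : ∫⁻ s, ENNReal.ofReal (Real.exp (-s)) ∂F < 1) {g : ℝ → ℂ} (hg : Measurable g)
    {K : ℝ} (hK : ∀ t, ‖g t‖ ≤ K * Real.exp t)
    (heq : ∀ t, g t = (Set.Iic t).indicator 1 (0 : ℝ) + ∫ s, g (t - s) ∂F) (t : ℝ) :
    ((renewalMeasure F (Set.Iic t)).toReal : ℂ) = g t := by
  set ρ := ∫⁻ s, ENNReal.ofReal (Real.exp (-s)) ∂F with hρ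
  have hρ' : ρ ≠ ⊤ := (hF.trans ENNReal.one_lt_top).ne
  have hexp : ∀ m, Integrable (fun s => Real.exp (-s)) (convPow F m) := fun m => by
    refine ⟨by fun_prop, ?_⟩
    rw [hasFiniteIntegral_iff_ofReal (ae_of_all _ fun s => Real.exp_nonneg _),
      lintegral_exp_neg_convPow]
    exact ENNReal.pow_lt_top hρ'.lt_top
  have hbd : ∀ s t, ‖g (t - s)‖ ≤ K * Real.exp t * Real.exp (-s) := fun s t => by
    rw [mul_assoc, ← Real.exp_add, ← sub_eq_add_neg]
    exact hK _
  have hint : ∀ m t, Integrable (fun s => g (t - s)) (convPow F m) := fun m t =>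
    ((hexp m).const_mul (K * Real.exp t)).mono'
      (hg.comp (measurable_const.sub measurable_id)).aestronglyMeasurable (ae_of_all _ fun s => hbd s t)
  -- The renewal equation integrated against `F^{*m}`; summing over `m` telescopes.
  have hstep : ∀ m, ∫ s, g (t - s) ∂(convPow F m) = ((convPow F m (Set.Iic t)).toReal : ℂ) +
      ∫ s, g (t - s) ∂(convPow F (m + 1)) := by
    intro m
    have h1 : ∫ s, g (t - s) ∂(convPow F (m + 1)) =
        ∫ x, (∫ y, g (t - (x + y)) ∂F) ∂(convPow F m) := integral_conv (hint (m + 1) t)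
    have h2 : ∀ x, ∫ y, g (t - (x + y)) ∂F = g (t - x) - (Set.Iic t).indicator 1 x := by
      intro x
      have := heq (t - x)
      simp only [sub_add_eq_sub_sub]
      rw [this]
      have : (Set.Iic (t - x)).indicator (1 : ℝ → ℂ) 0 = (Set.Iic t).indicator 1 x := by
        simp [Set.indicator_apply]
      rw [this]; ring
    simp only [h1, h2]
    have h3 : Integrable ((Set.Iic t).indicator (1 : ℝ → ℂ)) (convPow F m) :=
      (integrable_const (1 : ℂ)).indicator measurableSet_Iic
    have h4 : ∫ x, (Set.Iic t).indicator (1 : ℝ → ℂ) x ∂(convPow F m) =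
        ((convPow F m (Set.Iic t)).toReal : ℂ) := by
      rw [integral_indicator measurableSet_Iic]
      simp [measureReal_def]
    rw [integral_sub (hint m t) h3, h4]
    ring
  have hsum : ∀ M, ∑ m ∈ Finset.range M, ((convPow F m (Set.Iic t)).toReal : ℂ) =
      g t - ∫ s, g (t - s) ∂(convPow F M) := by
    intro M
    induction M with
    | zero => simp [convPow]
    | succ M ih => rw [Finset.sum_range_succ, ih, hstep M]; ring
  -- The growth bound makes the remainder at most `K e^t ρ^M`, with `ρ < 1`.
  have hlim : Tendsto (fun M => ∫ s, g (t - s) ∂(convPow F M)) atTop (𝓝 0) := by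
    have h1 : ∀ M, ‖∫ s, g (t - s) ∂(convPow F M)‖ ≤ K * Real.exp t * ρ.toReal ^ M := by
      intro M
      refine (norm_integral_le_of_norm_le ((hexp M).const_mul (K * Real.exp t))
        (ae_of_all _ fun s => hbd s t)).trans_eq ?_
      rw [integral_const_mul, integral_eq_lintegral_of_nonneg_ae
        (ae_of_all _ fun s => Real.exp_nonneg _) (by fun_prop), lintegral_exp_neg_convPow,
        ENNReal.toReal_pow]
    refine squeeze_zero_norm h1 ?_
    rw [← mul_zero (K * Real.exp t)]
    refine (tendsto_pow_atTop_nhds_zero_of_lt_one ENNReal.toReal_nonneg ?_).const_mul _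
    rwa [← ENNReal.toReal_one, ENNReal.toReal_lt_toReal hρ' ENNReal.one_ne_top]
  have hlim1 : Tendsto (fun M => ∑ m ∈ Finset.range M, ((convPow F m (Set.Iic t)).toReal : ℂ))
      atTop (𝓝 (g t)) := by
    simp only [hsum]
    simpa using hlim.const_sub (g t)
  have hfin := renewalMeasure_Iic_lt_top F hF t
  rw [renewalMeasure, Measure.sum_apply _ measurableSet_Iic] at hfin ⊢
  have hlim2 : HasSum (fun m => (convPow F m (Set.Iic t)).toReal)
      (∑' m, convPow F m (Set.Iic t)).toReal := by
    rw [ENNReal.tsum_toReal_eq fun m => measure_ne_top _ _]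
    exact (ENNReal.summable_toReal hfin.ne).hasSum
  exact tendsto_nhds_unique (Complex.hasSum_ofReal.2 hlim2).tendsto_sum_nat hlim1

/-! ### Asymptotics of the renewal function of a mixture -/

variable {ι : Type*} [Fintype ι]

namespace IsRationalRenewal

variable {γ : ℝ} {c l : ι → ℝ} {r : ι → ℂ} {i₀ : ι}

lemma lintegral_exp_neg_lt_one (h : IsRationalRenewal γ c l r i₀) :
    ∫⁻ s, ENNReal.ofReal (Real.exp (-s)) ∂(expMixture c l) < 1 := by
  have := h.isProbabilityMeasure
  have h1 : ∫⁻ _, (1 : ENNReal) ∂(expMixture c l) = 1 := by simp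
  conv_rhs => rw [← h1]
  have hlt : ∀ᵐ s ∂(expMixture c l), ENNReal.ofReal (Real.exp (-s)) < 1 := by
    filter_upwards [ae_expMixture_pos c l] with s hs
    rw [ENNReal.ofReal_lt_one]
    simpa using hs
  refine lintegral_strict_mono (IsProbabilityMeasure.ne_zero _) (by fun_prop) ?_ hlt
  refine ((lintegral_mono_ae (hlt.mono fun s hs => hs.le)).trans_lt ?_).ne
  rw [h1]; exact ENNReal.one_lt_top

variable [DecidableEq ι]

lemma renewalMeasure_Iic (h : IsRationalRenewal γ c l r i₀) (t : ℝ) :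
    ((renewalMeasure (expMixture c l) (Set.Iic t)).toReal : ℂ) = renewalFun l r t := by
  have := h.isProbabilityMeasure
  obtain ⟨K, hK⟩ := h.exists_norm_renewalFun_le
  exact renewalMeasure_Iic_eq _ h.lintegral_exp_neg_lt_one (measurable_renewalFun l r) hK
    h.renewal_equation t

/-- Expansion at `0` of the identity `(1 - φ) * (1 + ∑ coeff i / (x - r i)) = 1`. -/
lemma product_expansion (h : IsRationalRenewal γ c l r i₀) {x : ℂ} (hx0 : x ≠ 0)
    (hx : ∀ i, x ≠ r i) (hxl : ∀ j, (l j : ℂ) + x ≠ 0) :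
    (∑ j, (c j : ℂ) / l j ^ 2 - x * ∑ j, (c j : ℂ) / (l j ^ 2 * (l j + x))) *
      (coeff l r i₀ + x * (1 + ∑ i ∈ Finset.univ.erase i₀, coeff l r i / (x - r i))) = 1 := by
  have h0 : ∑ j, (c j : ℂ) / l j = 1 := by
    simpa [h.root_zero] using h.transform_root i₀
  have hA : x * (∑ j, (c j : ℂ) / l j ^ 2 - x * ∑ j, (c j : ℂ) / (l j ^ 2 * (l j + x))) =
      1 - ∑ j, (c j : ℂ) / (l j + x) := by
    rw [← h0, Finset.mul_sum, ← Finset.sum_sub_distrib, Finset.mul_sum, ← Finset.sum_sub_distrib]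
    refine Finset.sum_congr rfl fun j _ => ?_
    have h1 := hxl j
    have h2 : (l j : ℂ) ≠ 0 := Complex.ofReal_ne_zero.2 (h.rate_pos j).ne'
    field_simp
    ring
  -- Multiplying by `x` clears the pole at `r i₀ = 0`; `hA` supplies the matching factor `(1 -
  -- φ)/x`.
  have hB : coeff l r i₀ + x * (1 + ∑ i ∈ Finset.univ.erase i₀, coeff l r i / (x - r i)) =
      x * (1 + ∑ i, coeff l r i / (x - r i)) := by
    rw [← Finset.add_sum_erase _ _ (Finset.mem_univ i₀), h.root_zero, sub_zero]
    field_simp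
    ring
  have hP : ∏ i, (x - r i) ≠ 0 := Finset.prod_ne_zero_iff.2 fun i _ => sub_ne_zero.2 (hx i)
  have hN : ∏ j, ((l j : ℂ) + x) ≠ 0 := Finset.prod_ne_zero_iff.2 fun i _ => hxl i
  rw [hB, mul_left_comm, ← mul_assoc, hA, h.transform x hxl, h.sum_coeff_div hx]
  have := h.char x
  rw [this] at hN ⊢
  field_simp
  ring

/-- Coefficients of orders `0` and `1` at `x = 0` in `product_expansion`, compared by limits along
`x → 0`, `x ≠ 0`. -/
lemma mu_one_mul_coeff (h : IsRationalRenewal γ c l r i₀) :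
    (mu (expMixture c l) 1 : ℂ) * coeff l r i₀ = 1 ∧
      (mu (expMixture c l) 1 : ℂ) *
        (1 - ∑ i ∈ Finset.univ.erase i₀, coeff l r i / r i) =
      (mu (expMixture c l) 2 : ℂ) / 2 * coeff l r i₀ := by
  set m : ℂ → ℂ := fun x => ∑ j, (c j : ℂ) / (l j ^ 2 * (l j + x)) with hm
  set q : ℂ → ℂ := fun x => 1 + ∑ i ∈ Finset.univ.erase i₀, coeff l r i / (x - r i) with hq
  have hl : ∀ j, (l j : ℂ) ≠ 0 := fun j => Complex.ofReal_ne_zero.2 (h.rate_pos j).ne'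
  have hr : ∀ i ≠ i₀, r i ≠ 0 := fun i hi e => hi (h.injective (e.trans h.root_zero.symm))
  have hmu1 : (mu (expMixture c l) 1 : ℂ) = ∑ j, (c j : ℂ) / l j ^ 2 := by
    rw [h.mu_expMixture]
    push_cast
    exact Finset.sum_congr rfl fun j _ => by simp [div_eq_mul_inv]
  have hmu2 : (mu (expMixture c l) 2 : ℂ) / 2 = m 0 := by
    rw [h.mu_expMixture, hm]
    push_cast
    rw [Finset.sum_div]
    refine Finset.sum_congr rfl fun j _ => ?_
    have := hl j
    simp [Nat.factorial]
    field_simp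
  have hq0 : q 0 = 1 - ∑ i ∈ Finset.univ.erase i₀, coeff l r i / r i := by
    simp only [hq, zero_sub, div_neg, Finset.sum_neg_distrib, ← sub_eq_add_neg]
  have hmc : ContinuousAt m 0 := by
    refine tendsto_finsetSum _ fun j _ => ?_
    refine ContinuousAt.div (by fun_prop) (by fun_prop) ?_
    simpa using hl j
  have hqc : ContinuousAt q 0 := by
    refine continuousAt_const.add (tendsto_finsetSum _ fun i hi => ?_)
    refine ContinuousAt.div (by fun_prop) (by fun_prop) ?_
    simpa using hr i (Finset.ne_of_mem_erase hi)
  have hev : ∀ᶠ x : ℂ in 𝓝[≠] 0, (mu (expMixture c l) 1 - x * m x) *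
      (coeff l r i₀ + x * q x) = 1 := by
    have e1 : ∀ᶠ x : ℂ in 𝓝[≠] 0, ∀ j, (l j : ℂ) + x ≠ 0 := eventually_all.2 fun j =>
      nhdsWithin_le_nhds (ContinuousAt.eventually_ne (by fun_prop) (by simpa using hl j))
    have e2 : ∀ᶠ x : ℂ in 𝓝[≠] 0, ∀ i, x ≠ r i := eventually_all.2 fun i => by
      by_cases hi : i = i₀
      · rw [hi, h.root_zero]; exact self_mem_nhdsWithin
      · exact nhdsWithin_le_nhds (eventually_ne_nhds (hr i hi).symm)
    filter_upwards [e1, e2, self_mem_nhdsWithin] with x h1 h2 h3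
    rw [hmu1]
    exact h.product_expansion h3 h2 h1
  have hid : Tendsto (fun x : ℂ => x) (𝓝[≠] 0) (𝓝 0) := tendsto_id.mono_left nhdsWithin_le_nhds
  have hm' : Tendsto m (𝓝[≠] 0) (𝓝 (m 0)) := hmc.tendsto.mono_left nhdsWithin_le_nhds
  have hq' : Tendsto q (𝓝[≠] 0) (𝓝 (q 0)) := hqc.tendsto.mono_left nhdsWithin_le_nhds
  have first : (mu (expMixture c l) 1 : ℂ) * coeff l r i₀ = 1 := by
    have h1 := ((hid.mul hm').const_sub (mu (expMixture c l) 1 : ℂ)).mul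
      ((hid.mul hq').const_add (coeff l r i₀))
    rw [zero_mul, zero_mul, sub_zero, add_zero] at h1
    exact tendsto_nhds_unique h1
      (tendsto_const_nhds.congr' (hev.mono fun x hx => hx.symm))
  refine ⟨first, ?_⟩
  rw [← hq0, hmu2]
  have h1 := (hq'.const_mul (mu (expMixture c l) 1 : ℂ)).sub (hid.mul (hm'.mul hq'))
  have h2 := hm'.mul_const (coeff l r i₀)
  rw [zero_mul, sub_zero] at h1
  refine tendsto_nhds_unique h1 (h2.congr' ?_)
  filter_upwards [hev, self_mem_nhdsWithin] with x hx hx0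
  have hx0' : x ≠ 0 := hx0
  -- With `1` replaced by `μ_1 * coeff i₀` the terms of order `0` cancel and a factor `x` can be
  -- divided out.
  rw [← first] at hx
  have : x * (m x * coeff l r i₀) = x * (mu (expMixture c l) 1 * q x - x * (m x * q x)) := by
    linear_combination -hx
  exact mul_left_cancel₀ hx0' this

lemma mu_one_pos (h : IsRationalRenewal γ c l r i₀) : 0 < mu (expMixture c l) 1 := by
  refine lt_of_le_of_ne (mu_nonneg 1) fun e => ?_
  have := h.mu_one_mul_coeff.1
  rw [← e] at this
  simp at this

/-- The root `0` contributes exactly `t / μ_1`, and the constants left by the other roots add up to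
`μ_2/(2 μ_1^2)`. -/
lemma renewalError_sub (h : IsRationalRenewal γ c l r i₀) {t : ℝ} (ht : 0 ≤ t) :
    ((renewalError (expMixture c l) t -
      mu (expMixture c l) 2 / (2 * mu (expMixture c l) 1 ^ 2) : ℝ) : ℂ) =
    ∑ i ∈ Finset.univ.erase i₀, coeff l r i / r i * Complex.exp (r i * t) := by
  have h1 : (mu (expMixture c l) 1 : ℂ) ≠ 0 := Complex.ofReal_ne_zero.2 h.mu_one_pos.ne'
  obtain ⟨h2, h3⟩ := h.mu_one_mul_coeff
  have h4 : coeff l r i₀ = (mu (expMixture c l) 1 : ℂ)⁻¹ := eq_inv_of_mul_eq_one_right h2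
  have h5 : (mu (expMixture c l) 2 : ℂ) / (2 * mu (expMixture c l) 1 ^ 2) =
      1 - ∑ i ∈ Finset.univ.erase i₀, coeff l r i / r i := by
    rw [h4] at h3
    rw [eq_comm, eq_div_iff (by simpa using h1)]
    field_simp at h3
    linear_combination h3
  rw [renewalError]
  push_cast
  rw [h.renewalMeasure_Iic, h5, renewalFun, if_pos ht,
    ← Finset.add_sum_erase _ _ (Finset.mem_univ i₀), h4, h.root_zero]
  have h6 : ∀ i ∈ Finset.univ.erase i₀, coeff l r i * expInt (r i) t =
      coeff l r i / r i * Complex.exp (r i * t) - coeff l r i / r i := by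
    intro i hi
    have hr : r i ≠ 0 := fun e =>
      Finset.ne_of_mem_erase hi (h.injective (e.trans h.root_zero.symm))
    rw [expInt, if_neg hr]
    ring
  rw [Finset.sum_congr rfl h6, Finset.sum_sub_distrib]
  simp [expInt]
  ring

lemma isBigO_renewalError (h : IsRationalRenewal γ c l r i₀) :
    (fun t : ℝ => renewalError (expMixture c l) t -
        mu (expMixture c l) 2 / (2 * mu (expMixture c l) 1 ^ 2))
      =O[atTop] (fun t : ℝ => Real.exp (-γ * t)) := by
  refine IsBigO.of_bound (∑ i ∈ Finset.univ.erase i₀, ‖coeff l r i / r i‖) ?_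
  filter_upwards [eventually_ge_atTop 0] with t ht
  rw [← Complex.norm_real, h.renewalError_sub ht, Finset.sum_mul]
  refine (norm_sum_le _ _).trans (Finset.sum_le_sum fun i hi => ?_)
  rw [norm_mul, Complex.norm_exp, Real.norm_eq_abs, Real.abs_exp]
  gcongr
  have := h.root_re i (Finset.ne_of_mem_erase hi)
  simp only [Complex.mul_re, Complex.ofReal_re, Complex.ofReal_im, mul_zero, sub_zero]
  gcongr

end IsRationalRenewal
end DirichletBranching

/-! ### Gamma integrals and Dirichlet moments -/

namespace DirichletBranching

lemma lintegral_rpow_mul_exp_neg {a r : ℝ} (ha : 0 < a) (hr : 0 < r) :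
    ∫⁻ t in Set.Ioi 0, ENNReal.ofReal (t ^ (a - 1) * Real.exp (-(r * t))) =
      ENNReal.ofReal ((1 / r) ^ a * Real.Gamma a) := by
  have h := Real.integral_rpow_mul_exp_neg_mul_Ioi ha hr
  rw [← h, ofReal_integral_eq_lintegral_ofReal]
  · by_contra hc
    rw [integral_undef hc] at h
    have : 0 < (1 / r) ^ a * Real.Gamma a := mul_pos (by positivity) (Real.Gamma_pos_of_pos ha)
    exact this.ne h
  · refine (ae_restrict_iff' measurableSet_Ioi).2 (ae_of_all _ fun t ht => ?_)
    have : (0 : ℝ) < t := ht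
    simp only [Pi.zero_apply]
    positivity

lemma gammaMeasure_eq (a : ℝ) : gammaMeasure a 1 = (volume.restrict (Set.Ioi 0)).withDensity
    fun y => ENNReal.ofReal (1 / Real.Gamma a * (y ^ (a - 1) * Real.exp (-y))) := by
  rw [gammaMeasure, ← withDensity_indicator measurableSet_Ioi]
  refine withDensity_congr_ae ?_
  filter_upwards [compl_mem_ae_iff.2 (measure_singleton (μ := volume) (0 : ℝ))] with y hy
  rcases lt_or_gt_of_ne (show y ≠ 0 by simpa using hy) with h | h
  · rw [gammaPDF_of_neg h, Set.indicator_of_notMem (by simpa using h.le)]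
  · rw [gammaPDF_of_nonneg h.le, Set.indicator_of_mem (by simpa using h)]
    simp [mul_assoc]

lemma ae_gammaMeasure_pos (a : ℝ) : ∀ᵐ y ∂(gammaMeasure a 1), 0 < y := by
  rw [gammaMeasure_eq]
  exact (withDensity_absolutelyContinuous _ _).ae_le (ae_restrict_mem measurableSet_Ioi)

lemma lintegral_gammaMeasure {a q x : ℝ} (ha : 0 < a) (hq : 0 ≤ q) (hx : 0 ≤ x) :
    ∫⁻ y, ENNReal.ofReal (y ^ q * Real.exp (-(x * y))) ∂(gammaMeasure a 1) =
      ENNReal.ofReal (Real.Gamma (a + q) / Real.Gamma a * (1 / (1 + x)) ^ (a + q)) := by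
  have hG := Real.Gamma_pos_of_pos ha
  rw [gammaMeasure_eq, lintegral_withDensity_eq_lintegral_mul _ (by fun_prop) (by fun_prop)]
  have e : ∫⁻ y in Set.Ioi 0, ((fun y => ENNReal.ofReal (1 / Real.Gamma a *
      (y ^ (a - 1) * Real.exp (-y)))) * fun y => ENNReal.ofReal (y ^ q * Real.exp (-(x * y)))) y =
      ∫⁻ y in Set.Ioi 0, ENNReal.ofReal (1 / Real.Gamma a) *
        ENNReal.ofReal (y ^ (a + q - 1) * Real.exp (-((1 + x) * y))) := by
    refine setLIntegral_congr_fun measurableSet_Ioi fun y hy => ?_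
    have hy' : (0 : ℝ) < y := hy
    rw [Pi.mul_apply, ← ENNReal.ofReal_mul (by positivity), ← ENNReal.ofReal_mul (by positivity),
      show a + q - 1 = (a - 1) + q by ring, Real.rpow_add hy',
      show -((1 + x) * y) = -y + -(x * y) by ring, Real.exp_add]
    congr 1; ring
  rw [e, lintegral_const_mul _ (by fun_prop), lintegral_rpow_mul_exp_neg (by positivity)
    (by positivity), ← ENNReal.ofReal_mul (by positivity)]
  congr 1; ring

/-- The Beta integral on the half-line: write `(1+x)^{-(b+p)}` as a Gamma integral and exchange the
integrals. -/
lemma lintegral_rpow_mul_one_add_rpow {p b : ℝ} (hp : 0 < p) (hb : 0 < b) :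
    ∫⁻ x in Set.Ioi 0, ENNReal.ofReal (x ^ (p - 1) * (1 / (1 + x)) ^ (b + p)) =
      ENNReal.ofReal (Real.Gamma p * Real.Gamma b / Real.Gamma (b + p)) := by
  have hG := Real.Gamma_pos_of_pos (add_pos hb hp)
  have hGp := Real.Gamma_pos_of_pos hp
  have e1 : ∀ x ∈ Set.Ioi (0 : ℝ), ENNReal.ofReal (x ^ (p - 1) * (1 / (1 + x)) ^ (b + p)) =
      ∫⁻ u in Set.Ioi 0, ENNReal.ofReal (1 / Real.Gamma (b + p)) *
        (ENNReal.ofReal (x ^ (p - 1)) *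
        ENNReal.ofReal (u ^ (b + p - 1) * Real.exp (-((1 + x) * u)))) := by
    intro x hx
    have hx' : (0 : ℝ) < x := hx
    rw [lintegral_const_mul _ (by fun_prop), lintegral_const_mul _ (by fun_prop),
      lintegral_rpow_mul_exp_neg (by positivity) (by positivity),
      ← ENNReal.ofReal_mul (by positivity), ← ENNReal.ofReal_mul (by positivity)]
    congr 1; field_simp
  rw [setLIntegral_congr_fun measurableSet_Ioi e1, lintegral_lintegral_swap (by
    refine Measurable.aemeasurable ?_
    fun_prop)]
  have e2 : ∀ u ∈ Set.Ioi (0 : ℝ), ∫⁻ x in Set.Ioi 0, ENNReal.ofReal (1 / Real.Gamma (b + p)) *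
        (ENNReal.ofReal (x ^ (p - 1)) *
        ENNReal.ofReal (u ^ (b + p - 1) * Real.exp (-((1 + x) * u)))) =
      ENNReal.ofReal (Real.Gamma p / Real.Gamma (b + p)) *
        ENNReal.ofReal (u ^ (b - 1) * Real.exp (-(1 * u))) := by
    intro u hu
    have hu' : (0 : ℝ) < u := hu
    have e3 : ∀ x ∈ Set.Ioi (0 : ℝ), ENNReal.ofReal (1 / Real.Gamma (b + p)) *
        (ENNReal.ofReal (x ^ (p - 1)) *
        ENNReal.ofReal (u ^ (b + p - 1) * Real.exp (-((1 + x) * u)))) =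
        ENNReal.ofReal (1 / Real.Gamma (b + p) * (u ^ (b + p - 1) * Real.exp (-u))) *
        ENNReal.ofReal (x ^ (p - 1) * Real.exp (-(u * x))) := by
      intro x hx
      have hx' : (0 : ℝ) < x := hx
      rw [← ENNReal.ofReal_mul (by positivity), ← ENNReal.ofReal_mul (by positivity),
        ← ENNReal.ofReal_mul (by positivity),
        show -((1 + x) * u) = -u + -(u * x) by ring, Real.exp_add]
      congr 1; ring
    rw [setLIntegral_congr_fun measurableSet_Ioi e3, lintegral_const_mul _ (by fun_prop),
      lintegral_rpow_mul_exp_neg hp hu', ← ENNReal.ofReal_mul (by positivity),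
      ← ENNReal.ofReal_mul (by positivity), show b + p - 1 = (b - 1) + p by ring,
      Real.rpow_add hu', one_mul, Real.div_rpow zero_le_one hu'.le, Real.one_rpow]
    have : u ^ p ≠ 0 := (Real.rpow_pos_of_pos hu' p).ne'
    congr 1; field_simp
  rw [setLIntegral_congr_fun measurableSet_Ioi e2, lintegral_const_mul _ (by fun_prop),
    lintegral_rpow_mul_exp_neg hb one_pos, ← ENNReal.ofReal_mul (by positivity)]
  congr 1; simp; ring

lemma lintegral_pi_prod {n : ℕ} (μ : Fin n → Measure ℝ) [∀ i, IsProbabilityMeasure (μ i)]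
    {f : Fin n → ℝ → ENNReal} (hf : ∀ i, Measurable (f i)) :
    ∫⁻ y, ∏ i, f i (y i) ∂(Measure.pi μ) = ∏ i, ∫⁻ x, f i x ∂(μ i) := by
  refine (lintegral_prod_eq_prod_lintegral_of_indepFun (μ := Measure.pi μ) Finset.univ
    (fun i (y : Fin n → ℝ) => f i (y i)) (iIndepFun_pi fun i => (hf i).aemeasurable)
    fun i => (hf i).comp (measurable_pi_apply i)).trans ?_
  refine Finset.prod_congr rfl fun i _ => ?_
  exact (measurePreserving_eval μ i).lintegral_comp (hf i)

/-- The moments of a coordinate of a symmetric Dirichlet distribution. -/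
lemma lintegral_rpow_dirichletMeasure {n : ℕ} {α : Fin n → ℝ} {a p : ℝ} (ha : 0 < a) (hp : 0 < p)
    (hα : ∀ i, α i = a) (i : Fin n) :
    ∫⁻ v, ENNReal.ofReal (v i ^ p) ∂(dirichletMeasure α) =
      ENNReal.ofReal (Real.Gamma (a + p) * Real.Gamma (n * a) /
        (Real.Gamma a * Real.Gamma (n * a + p))) := by
  have hn : 0 < (n : ℝ) := Nat.cast_pos.2 i.pos
  have hG := Real.Gamma_pos_of_pos ha
  have hGp := Real.Gamma_pos_of_pos hp
  have hGap := Real.Gamma_pos_of_pos (add_pos ha hp)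
  have hprob : ∀ j, IsProbabilityMeasure (gammaMeasure (α j) 1) := fun j =>
    isProbabilityMeasure_gammaMeasure (by rwa [hα]) one_pos
  set q : Fin n → ℝ := fun j => if j = i then p else 0 with hq
  have hq0 : ∀ j, 0 ≤ q j := fun j => by simp only [hq]; split_ifs <;> positivity
  have hqs : ∑ j, (a + q j) = n * a + p := by simp [Finset.sum_add_distrib, hq]
  rw [dirichletMeasure, lintegral_map (by fun_prop) (by fun_prop)]
  have hpos : ∀ᵐ y ∂(Measure.pi fun j => gammaMeasure (α j) 1), ∀ j, 0 < y j :=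
    ae_all_iff.2 fun j =>
      (Measure.quasiMeasurePreserving_eval (fun j => gammaMeasure (α j) 1) j).ae
        (ae_gammaMeasure_pos (α j))
  -- Writing `S^{-p} = Γ(p)⁻¹ ∫ x^{p-1} e^{-S x} dx` for the sum `S` of the `y j` makes the
  -- integrand a product over coordinates, so independence applies after a swap.
  have e1 : ∀ᵐ y ∂(Measure.pi fun j => gammaMeasure (α j) 1),
      ENNReal.ofReal ((y i / ∑ j, y j) ^ p) = ∫⁻ x in Set.Ioi 0,
        ENNReal.ofReal (1 / Real.Gamma p * x ^ (p - 1)) *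
          ∏ j, ENNReal.ofReal (y j ^ q j * Real.exp (-(x * y j))) := by
    filter_upwards [hpos] with y hy
    have hS : 0 < ∑ j, y j := Finset.sum_pos (fun j _ => hy j) ⟨i, Finset.mem_univ i⟩
    have hyi := hy i
    have e2 : ∀ x ∈ Set.Ioi (0 : ℝ), ENNReal.ofReal (1 / Real.Gamma p * x ^ (p - 1)) *
          ∏ j, ENNReal.ofReal (y j ^ q j * Real.exp (-(x * y j))) =
        ENNReal.ofReal (1 / Real.Gamma p * y i ^ p) *
          ENNReal.ofReal (x ^ (p - 1) * Real.exp (-((∑ j, y j) * x))) := by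
      intro x hx
      have hx' : (0 : ℝ) < x := hx
      rw [← ENNReal.ofReal_prod_of_nonneg fun j _ => mul_nonneg
        (Real.rpow_nonneg (hy j).le _) (Real.exp_nonneg _), Finset.prod_mul_distrib,
        ← Real.exp_sum, ← ENNReal.ofReal_mul (by positivity), ← ENNReal.ofReal_mul (by positivity),
        Finset.sum_neg_distrib, ← Finset.mul_sum, mul_comm x (∑ j, y j)]
      have : ∏ j, y j ^ q j = y i ^ p := by
        rw [Finset.prod_eq_single i (fun j _ hj => by simp [hq, hj]) (by simp)]
        simp [hq]
      rw [this]
      congr 1; ring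
    rw [setLIntegral_congr_fun measurableSet_Ioi e2, lintegral_const_mul _ (by fun_prop),
      lintegral_rpow_mul_exp_neg hp hS, ← ENNReal.ofReal_mul (by positivity),
      Real.div_rpow hyi.le hS.le, Real.div_rpow zero_le_one hS.le, Real.one_rpow]
    congr 1; field_simp
  rw [lintegral_congr_ae e1, lintegral_lintegral_swap (by
    refine Measurable.aemeasurable ?_
    fun_prop)]
  have e3 : ∀ x ∈ Set.Ioi (0 : ℝ), ∫⁻ y, ENNReal.ofReal (1 / Real.Gamma p * x ^ (p - 1)) *
          ∏ j, ENNReal.ofReal (y j ^ q j * Real.exp (-(x * y j)))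
          ∂(Measure.pi fun j => gammaMeasure (α j) 1) =
        ENNReal.ofReal (Real.Gamma (a + p) / (Real.Gamma a * Real.Gamma p)) *
          ENNReal.ofReal (x ^ (p - 1) * (1 / (1 + x)) ^ (n * a + p)) := by
    intro x hx
    have hx' : (0 : ℝ) < x := hx
    rw [lintegral_const_mul _ (by fun_prop), lintegral_pi_prod _
      (f := fun j z => ENNReal.ofReal (z ^ q j * Real.exp (-(x * z)))) (fun j => by fun_prop)]
    simp only [hα]
    simp only [lintegral_gammaMeasure ha (hq0 _) hx'.le]
    rw [← ENNReal.ofReal_prod_of_nonneg fun j _ => mul_nonneg (div_nonneg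
        (Real.Gamma_nonneg_of_nonneg (add_nonneg ha.le (hq0 j))) hG.le)
        (by positivity), Finset.prod_mul_distrib,
      ← Real.rpow_sum_of_pos (by positivity), hqs]
    have : ∏ j, Real.Gamma (a + q j) / Real.Gamma a = Real.Gamma (a + p) / Real.Gamma a := by
      rw [Finset.prod_eq_single i (fun j _ hj => by simp [hq, hj, hG.ne']) (by simp)]
      simp [hq]
    rw [this, ← ENNReal.ofReal_mul (by positivity), ← ENNReal.ofReal_mul (by positivity)]
    congr 1; field_simp
  rw [setLIntegral_congr_fun measurableSet_Ioi e3, lintegral_const_mul _ (by fun_prop),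
    lintegral_rpow_mul_one_add_rpow hp (by positivity), ← ENNReal.ofReal_mul (by positivity)]
  congr 1; field_simp

/-! ### The measure `ν_γ` and its exponential moments -/

lemma discountedReproduction_apply {Ω : Type*} {n : ℕ} (γ : ℝ) (σ : Fin n → Ω → ℝ) (ω : Ω)
    {f : ℝ → ENNReal} (hf : Measurable f) :
    ∫⁻ t, f t ∂(discountedReproduction γ σ ω) =
      ∑ i, ENNReal.ofReal (Real.exp (-γ * σ i ω)) * f (σ i ω) := by
  rw [discountedReproduction, lintegral_withDensity_eq_lintegral_mul _ (by fun_prop) hf,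
    reproduction, lintegral_finsetSum_measure]
  refine Finset.sum_congr rfl fun i _ => ?_
  rw [lintegral_dirac' _ (by fun_prop)]
  rfl

lemma aemeasurable_discountedReproduction {Ω : Type*} [MeasurableSpace Ω] {P : Measure Ω} {n : ℕ}
    (γ : ℝ) {σ : Fin n → Ω → ℝ} (hσ : ∀ i, AEMeasurable (σ i) P) :
    AEMeasurable (discountedReproduction γ σ) P := by
  have h : Measurable (discountedReproduction γ fun (i : Fin n) (v : Fin n → ℝ) => v i) := by
    refine Measure.measurable_of_measurable_coe _ fun s hs => ?_
    simp_rw [← lintegral_indicator_one hs,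
      discountedReproduction_apply γ _ _ (measurable_one.indicator hs)]
    have := (measurable_one (α := ENNReal) (β := ℝ)).indicator hs
    fun_prop
  exact h.comp_aemeasurable (aemeasurable_pi_lambda _ hσ)

lemma lintegral_nuGamma {Ω : Type*} [MeasurableSpace Ω] {P : Measure Ω} {n : ℕ}
    (γ : ℝ) {σ : Fin n → Ω → ℝ} (hσ : ∀ i, AEMeasurable (σ i) P) {f : ℝ → ENNReal}
    (hf : Measurable f) :
    ∫⁻ t, f t ∂(nuGamma P γ σ) =
      ∑ i, ∫⁻ ω, ENNReal.ofReal (Real.exp (-γ * σ i ω)) * f (σ i ω) ∂P := by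
  rw [nuGamma, Measure.lintegral_bind (aemeasurable_discountedReproduction γ hσ) hf.aemeasurable]
  simp_rw [discountedReproduction_apply γ _ _ hf]
  exact lintegral_finsetSum' _ fun i _ => by
    have := hf.comp_aemeasurable (hσ i)
    have h2 := hσ i
    exact AEMeasurable.mul (by fun_prop) this

/-- Since `e^{-γσ} e^{tσ} = (e^{-γσ})^{1 - t/γ}`, these are Dirichlet moments of order `1 - t/γ`. -/
lemma lintegral_exp_nuGamma {Ω : Type*} [MeasurableSpace Ω] {P : Measure Ω} {n : ℕ}
    {γ : ℝ} (hγ : 0 < γ) {σ : Fin n → Ω → ℝ} (hσ : ∀ i, AEMeasurable (σ i) P)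
    {α : Fin n → ℝ} {a : ℝ} (ha : 0 < a) (hα : ∀ i, α i = a)
    (hlaw : HasLaw (fun ω i => Real.exp (-γ * σ i ω)) (dirichletMeasure α) P) {t : ℝ}
    (ht : t < γ) :
    ∫⁻ s, ENNReal.ofReal (Real.exp (t * s)) ∂(nuGamma P γ σ) =
      n * ENNReal.ofReal (Real.Gamma (a + (1 - t / γ)) * Real.Gamma (n * a) /
        (Real.Gamma a * Real.Gamma (n * a + (1 - t / γ)))) := by
  have hp : 0 < 1 - t / γ := sub_pos.2 ((div_lt_one hγ).2 ht)
  rw [lintegral_nuGamma γ hσ (by fun_prop)]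
  have e : ∀ i, ∫⁻ ω, ENNReal.ofReal (Real.exp (-γ * σ i ω)) *
      ENNReal.ofReal (Real.exp (t * σ i ω)) ∂P = ENNReal.ofReal (Real.Gamma (a + (1 - t / γ)) *
        Real.Gamma (n * a) / (Real.Gamma a * Real.Gamma (n * a + (1 - t / γ)))) := by
    intro i
    rw [← lintegral_rpow_dirichletMeasure ha hp hα i, ← hlaw.map_eq,
      lintegral_map' (Measurable.aemeasurable (by fun_prop)) hlaw.aemeasurable]
    refine lintegral_congr fun ω => ?_
    rw [← ENNReal.ofReal_mul (Real.exp_nonneg _), ← Real.exp_add, ← Real.exp_mul]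
    congr 2; field_simp; ring
  rw [Finset.sum_congr rfl fun i _ => e i]
  simp

lemma Gamma_add_nat {y : ℝ} (hy : 0 < y) (k : ℕ) :
    Real.Gamma (y + k) = (∏ j ∈ Finset.range k, (y + j)) * Real.Gamma y := by
  induction k with
  | zero => simp
  | succ k ih =>
    rw [Nat.cast_succ, ← add_assoc, Real.Gamma_add_one (by positivity), ih,
      Finset.prod_range_succ]
    ring

/-- As `n a` exceeds `a` by the integer `k`, both Gamma quotients are rising factorials; the factor
`n = (a+k)/a` shifts the numerator from `a + j` to `a + 1 + j`. -/
lemma dirichlet_moment_eq {a x : ℝ} {n k : ℕ} (ha : 0 < a) (hx : 0 < 1 + x) (hn : n * a = a + k) :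
    n * (Real.Gamma (a + (1 + x)) * Real.Gamma (n * a) /
        (Real.Gamma a * Real.Gamma (n * a + (1 + x)))) =
      (∏ j ∈ Finset.range k, (a + 1 + j)) / ∏ j ∈ Finset.range k, (a + 1 + j + x) := by
  have hG := (Real.Gamma_pos_of_pos ha).ne'
  have hG' := (Real.Gamma_pos_of_pos (add_pos ha hx)).ne'
  have hn' : (n : ℝ) = (a + k) / a := by rw [← hn]; field_simp
  have h1 : (a + k) * ∏ j ∈ Finset.range k, (a + j) = a * ∏ j ∈ Finset.range k, (a + 1 + j) := by
    rw [mul_comm, ← Finset.prod_range_succ (fun j : ℕ => a + (j : ℝ)), Finset.prod_range_succ']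
    rw [mul_comm]
    simp only [Nat.cast_zero, add_zero, Nat.cast_succ]
    congr 1
    exact Finset.prod_congr rfl fun j _ => by ring
  have h2 : ∏ j ∈ Finset.range k, (a + (1 + x) + j) = ∏ j ∈ Finset.range k, (a + 1 + j + x) :=
    Finset.prod_congr rfl fun j _ => by ring
  have h3 : ∏ j ∈ Finset.range k, (a + 1 + j + x) ≠ 0 := Finset.prod_ne_zero_iff.2 fun j _ => by
    have : (0 : ℝ) ≤ j := j.cast_nonneg
    exact (show 0 < a + 1 + j + x by linarith).ne'
  rw [hn, show a + (k : ℝ) + (1 + x) = a + (1 + x) + k by ring, Gamma_add_nat ha,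
    Gamma_add_nat (add_pos ha hx), h2, hn']
  field_simp
  linear_combination h1

/-- Finite measures with the same finite moment generating function on a half-line that has `0`
in its interior are equal. -/
theorem ext_of_lintegral_exp {μ μ' : Measure ℝ} [IsFiniteMeasure μ] [IsFiniteMeasure μ'] {δ : ℝ}
    (hδ : 0 < δ) (hfin : ∀ t < δ, ∫⁻ s, ENNReal.ofReal (Real.exp (t * s)) ∂μ < ⊤)
    (heq : ∀ t < δ, ∫⁻ s, ENNReal.ofReal (Real.exp (t * s)) ∂μ =
      ∫⁻ s, ENNReal.ofReal (Real.exp (t * s)) ∂μ') : μ = μ' := by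
  have hsub : ∀ ρ : Measure ℝ, (∀ t < δ, ∫⁻ s, ENNReal.ofReal (Real.exp (t * s)) ∂ρ < ⊤) →
      Set.Iio δ ⊆ interior (integrableExpSet id ρ) := by
    intro ρ hρ
    refine interior_maximal (fun t ht => ⟨by fun_prop, ?_⟩) isOpen_Iio
    rw [hasFiniteIntegral_iff_ofReal (ae_of_all _ fun s => Real.exp_nonneg _)]
    exact hρ t ht
  have hμ := hsub μ hfin
  have hμ' := hsub μ' fun t ht => by rw [← heq t ht]; exact hfin t ht
  have hreal : ∀ t < δ, complexMGF id μ (t : ℂ) = complexMGF id μ' (t : ℂ) := by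
    intro t ht
    rw [complexMGF_ofReal, complexMGF_ofReal, mgf, mgf,
      integral_eq_lintegral_of_nonneg_ae (ae_of_all _ fun s => Real.exp_nonneg _) (by fun_prop),
      integral_eq_lintegral_of_nonneg_ae (ae_of_all _ fun s => Real.exp_nonneg _) (by fun_prop)]
    simp only [id, heq t ht]
  have hEq : Set.EqOn (complexMGF id μ) (complexMGF id μ') {z : ℂ | z.re < δ} := by
    refine AnalyticOnNhd.eqOn_of_preconnected_of_frequently_eq
      (analyticOnNhd_complexMGF.mono fun z hz => hμ hz)
      (analyticOnNhd_complexMGF.mono fun z hz => hμ' hz)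
      (convex_halfSpace_re_lt δ).isPreconnected (z₀ := 0) (by simpa using hδ) ?_
    -- Real points accumulating at `0`, as the identity theorem requires; the imaginary axis, where
    -- the characteristic functions live, lies in the half-plane.
    have h1 : Tendsto (fun m : ℕ => ((-(1 / ((m : ℝ) + 1)) : ℝ) : ℂ)) atTop (𝓝[≠] 0) := by
      refine tendsto_nhdsWithin_iff.2 ⟨?_, Eventually.of_forall fun m => ?_⟩
      · have := (tendsto_one_div_add_atTop_nhds_zero_nat (𝕜 := ℝ)).neg
        rw [neg_zero] at this
        have h2 := (Complex.continuous_ofReal.tendsto 0).comp this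
        rwa [Complex.ofReal_zero] at h2
      · simp only [Set.mem_compl_iff, Set.mem_singleton_iff, Complex.ofReal_eq_zero]
        have : (0 : ℝ) < 1 / ((m : ℝ) + 1) := by positivity
        linarith
    refine h1.frequently (Eventually.frequently (Eventually.of_forall fun m => hreal _ ?_))
    have : (0 : ℝ) < 1 / ((m : ℝ) + 1) := by positivity
    linarith
  refine Measure.ext_of_charFun (funext fun t => ?_)
  rw [← complexMGF_id_mul_I, ← complexMGF_id_mul_I]
  exact hEq (by simpa using hδ)

end DirichletBranching

/-! ### Explicit densities and roots for `k ≤ 4` -/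

namespace DirichletBranching

lemma IsRationalRenewal.lintegral_exp {ι : Type*} [Fintype ι] {γ : ℝ} {c l : ι → ℝ} {r : ι → ℂ}
    {i₀ : ι} (h : IsRationalRenewal γ c l r i₀) {t : ℝ} (ht : t < γ) :
    ∫⁻ s, ENNReal.ofReal (Real.exp (t * s)) ∂(expMixture c l) =
      ENNReal.ofReal (∏ j, l j / (l j - t)) := by
  have hw : ∀ j, (t : ℂ).re < l j := fun j => by simpa using ht.trans (h.lt_rate j)
  have h1 := h.fourierTransform_expMixture hw
  rw [h.sum_div_eq (by simpa using ht.le), fourierTransform] at h1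
  have h2 := h.integrable_exp hw
  have e : ∀ s : ℝ, Complex.exp (t * s) = (Real.exp (t * s) : ℂ) := fun s => by push_cast; rfl
  simp only [e] at h1 h2
  rw [integral_complex_ofReal, ← Finset.prod_div_distrib] at h1
  have h3 : Integrable (fun s => Real.exp (t * s)) (expMixture c l) := by
    exact h2.re
  rw [← ofReal_integral_eq_lintegral_ofReal h3 (ae_of_all _ fun s => Real.exp_nonneg _)]
  congr 1
  exact_mod_cast h1

/-- The rates `γ u, γ (u + 1), …, γ (u + k - 1)`. -/
noncomputable def arithRate (γ u : ℝ) (k : ℕ) (j : Fin k) : ℝ := γ * (u + (j : ℕ))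

/-- Exposes positivity: below, the `c j` are alternating binomial coefficients times `K = ∏ l j /
((k-1)! γ^(k-1))`, and the polynomial factor is `K (1 - e^{-γ s})^(k-1)`. -/
lemma expSum_arithRate (γ u : ℝ) {k : ℕ} (c : Fin k → ℝ) (s : ℝ) :
    expSum c (arithRate γ u k) s =
      Real.exp (-(γ * u) * s) * ∑ j, c j * Real.exp (-γ * s) ^ (j : ℕ) := by
  rw [expSum, Finset.mul_sum]
  refine Finset.sum_congr rfl fun j _ => ?_
  rw [arithRate, ← Real.exp_nat_mul, mul_left_comm, ← Real.exp_add]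
  congr 2; ring

lemma exists_isRationalRenewal_one {γ u : ℝ} (hγ : 0 < γ) (hu : 1 < u) :
    ∃ c r i₀, IsRationalRenewal γ c (arithRate γ u 1) r i₀ := by
  refine ⟨![γ * u], ![0], 0, hγ, ?_, ?_, ?_, ?_, ?_, ?_, ?_⟩
  · intro j; fin_cases j; simp only [arithRate]; norm_num; nlinarith
  · intro s hs; simp [expSum]; positivity
  · intro i j _; exact Subsingleton.elim _ _
  · simp
  · intro i hi; exact absurd (Subsingleton.elim _ _) hi
  · intro x; simp [arithRate]
  · intro x hx; simp [arithRate]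

lemma exists_isRationalRenewal_two {γ u : ℝ} (hγ : 0 < γ) (hu : 1 < u) :
    ∃ c r i₀, IsRationalRenewal γ c (arithRate γ u 2) r i₀ := by
  have hγ' : (γ : ℂ) ≠ 0 := Complex.ofReal_ne_zero.2 hγ.ne'
  have hγu : γ < γ * u := by nlinarith
  set K : ℝ := γ * u * (γ * (u + 1)) / γ with hK
  have hK0 : 0 ≤ K := by positivity
  refine ⟨![K, -K], ![0, ⟨-(γ * (2 * u + 1)), 0⟩], 0, hγ, ?_, ?_, ?_, ?_, ?_, ?_, ?_⟩
  · intro j; fin_cases j <;> simp only [arithRate] <;> norm_num <;> nlinarith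
  · intro s hs
    have e1 : Real.exp (-γ * s) ≤ 1 := Real.exp_le_one_iff.2 (by nlinarith)
    have : expSum ![K, -K] (arithRate γ u 2) s =
        K * Real.exp (-(γ * u) * s) * (1 - Real.exp (-γ * s)) := by
      rw [expSum_arithRate, Fin.sum_univ_two]
      simp; ring
    rw [this]
    have := sub_nonneg.2 e1
    positivity
  · intro i j hij
    have hre := congrArg Complex.re hij
    fin_cases i <;> fin_cases j <;> simp at hre ⊢ <;> rcases hre with h | h <;> linarith
  · simp
  · intro i hi
    fin_cases i
    · simp at hi
    · simp; nlinarith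
  · intro x
    simp [arithRate, Complex.mk_eq_add_mul_I]; ring
  · intro x hx
    have h0 := hx 0
    have h1 := hx 1
    simp [arithRate] at h0 h1
    simp [arithRate, hK, Fin.sum_univ_two]
    field_simp
    ring

lemma exists_isRationalRenewal_three {γ u : ℝ} (hγ : 0 < γ) (hu : 1 < u) :
    ∃ c r i₀, IsRationalRenewal γ c (arithRate γ u 3) r i₀ := by
  have hγ' : (γ : ℂ) ≠ 0 := Complex.ofReal_ne_zero.2 hγ.ne'
  have hγu : γ < γ * u := by nlinarith
  set K : ℝ := γ * u * (γ * (u + 1)) * (γ * (u + 2)) / (2 * γ ^ 2) with hK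
  have hK0 : 0 ≤ K := by positivity
  -- `Q` is the mean rate. With `y = x + Q` the equation is `y^3 - γ^2 y = Q^3 - γ^2 Q`; removing `y
  -- = Q` leaves `y^2 + Q y + Q^2 - γ^2 = 0`, with roots `-Q/2 ± i D`.
  obtain ⟨Q, hQ⟩ : ∃ Q, Q = γ * (u + 1) := ⟨_, rfl⟩
  have hQ2 : 2 * γ < Q := by rw [hQ]; linarith
  obtain ⟨D, hD0, hD⟩ : ∃ D : ℝ, 0 < D ∧ D ^ 2 = 3 / 4 * Q ^ 2 - γ ^ 2 := by
    have : 0 < 3 / 4 * Q ^ 2 - γ ^ 2 := by nlinarith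
    exact ⟨_, Real.sqrt_pos.2 this, Real.sq_sqrt this.le⟩
  refine ⟨![K, -(2 * K), K], ![0, ⟨-(3 / 2 * Q), D⟩, ⟨-(3 / 2 * Q), -D⟩], 0, hγ,
    ?_, ?_, ?_, ?_, ?_, ?_, ?_⟩
  · intro j; fin_cases j <;> simp only [arithRate] <;> norm_num <;> nlinarith
  · intro s hs
    have : expSum ![K, -(2 * K), K] (arithRate γ u 3) s =
        K * Real.exp (-(γ * u) * s) * (1 - Real.exp (-γ * s)) ^ 2 := by
      rw [expSum_arithRate, Fin.sum_univ_three]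
      simp; ring
    rw [this]
    positivity
  · intro i j hij
    have hre := congrArg Complex.re hij
    have him := congrArg Complex.im hij
    fin_cases i <;> fin_cases j <;> simp at hre him ⊢ <;> linarith
  · simp
  · intro i hi
    fin_cases i
    · simp at hi
    · simp; linarith
    · simp; linarith
  · intro x
    have hDc : (D : ℂ) ^ 2 = 3 / 4 * (Q : ℂ) ^ 2 - (γ : ℂ) ^ 2 := by
      rw [← Complex.ofReal_pow, hD]; push_cast; ring
    have hQc : (Q : ℂ) = γ * (u + 1) := by exact_mod_cast hQ
    have hI := Complex.I_sq
    simp [arithRate, Complex.mk_eq_add_mul_I, Fin.prod_univ_three]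
    rw [show (u : ℂ) = (Q - γ) / γ by rw [hQc]; field_simp; ring]
    field_simp
    linear_combination (-4 * x) * hDc + 4 * x * (D : ℂ) ^ 2 * hI
  · intro x hx
    have h0 := hx 0
    have h1 := hx 1
    have h2 := hx 2
    simp [arithRate] at h0 h1 h2
    simp [arithRate, hK, Fin.sum_univ_three, Fin.prod_univ_three]
    field_simp
    ring

lemma exists_isRationalRenewal_four {γ u : ℝ} (hγ : 0 < γ) (hu : 1 < u) :
    ∃ c r i₀, IsRationalRenewal γ c (arithRate γ u 4) r i₀ := by
  have hγ' : (γ : ℂ) ≠ 0 := Complex.ofReal_ne_zero.2 hγ.ne'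
  have hγu : γ < γ * u := by nlinarith
  set K : ℝ := γ * u * (γ * (u + 1)) * (γ * (u + 2)) * (γ * (u + 3)) / (6 * γ ^ 3) with hK
  have hK0 : 0 ≤ K := by positivity
  -- Again the mean rate. With `y = x + Q` the equation is quadratic in `y^2`, since the rates are
  -- `Q ± γ/2` and `Q ± 3γ/2`; its solutions are `y^2 = Q^2` and `y^2 = 5/2 γ^2 - Q^2 = -D^2`.
  obtain ⟨Q, hQ⟩ : ∃ Q, Q = γ * (u + 3 / 2) := ⟨_, rfl⟩
  have hQ2 : 5 / 2 * γ < Q := by rw [hQ]; linarith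
  obtain ⟨D, hD0, hD⟩ : ∃ D : ℝ, 0 < D ∧ D ^ 2 = Q ^ 2 - 5 / 2 * γ ^ 2 := by
    have : 0 < Q ^ 2 - 5 / 2 * γ ^ 2 := by nlinarith
    exact ⟨_, Real.sqrt_pos.2 this, Real.sq_sqrt this.le⟩
  refine ⟨![K, -(3 * K), 3 * K, -K], ![0, ⟨-(2 * Q), 0⟩, ⟨-Q, D⟩, ⟨-Q, -D⟩], 0, hγ,
    ?_, ?_, ?_, ?_, ?_, ?_, ?_⟩
  · intro j; fin_cases j <;> simp only [arithRate] <;> norm_num <;> nlinarith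
  · intro s hs
    have e1 : Real.exp (-γ * s) ≤ 1 := Real.exp_le_one_iff.2 (by nlinarith)
    have : expSum ![K, -(3 * K), 3 * K, -K] (arithRate γ u 4) s =
        K * Real.exp (-(γ * u) * s) * (1 - Real.exp (-γ * s)) ^ 3 := by
      rw [expSum_arithRate, Fin.sum_univ_four]
      simp; ring
    rw [this]
    have := sub_nonneg.2 e1
    positivity
  · intro i j hij
    have hre := congrArg Complex.re hij
    have him := congrArg Complex.im hij
    fin_cases i <;> fin_cases j <;> simp at hre him ⊢ <;> linarith
  · simp
  · intro i hi
    fin_cases i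
    · simp at hi
    · simp; linarith
    · simp; linarith
    · simp; linarith
  · intro x
    have hDc : (D : ℂ) ^ 2 = (Q : ℂ) ^ 2 - 5 / 2 * (γ : ℂ) ^ 2 := by
      rw [← Complex.ofReal_pow, hD]; push_cast; ring
    have hQc : (Q : ℂ) = γ * (u + 3 / 2) := by rw [hQ]; push_cast; ring
    have hI := Complex.I_sq
    simp [arithRate, Complex.mk_eq_add_mul_I, Fin.prod_univ_four]
    rw [show (u : ℂ) = (Q - 3 / 2 * γ) / γ by rw [hQc]; field_simp; ring]
    field_simp
    linear_combination (-16 * x * (x + 2 * Q)) * hDc + 16 * x * (x + 2 * Q) * (D : ℂ) ^ 2 * hI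
  · intro x hx
    have h0 := hx 0
    have h1 := hx 1
    have h2 := hx 2
    have h3 := hx 3
    simp [arithRate] at h0 h1 h2 h3
    simp [arithRate, hK, Fin.sum_univ_four, Fin.prod_univ_four]
    field_simp
    ring

lemma exists_isRationalRenewal {γ u : ℝ} (hγ : 0 < γ) (hu : 1 < u) {k : ℕ}
    (hk : k ∈ ({1, 2, 3, 4} : Set ℕ)) :
    ∃ c r i₀, IsRationalRenewal γ c (arithRate γ u k) r i₀ := by
  rcases hk with rfl | rfl | rfl | rfl
  exacts [exists_isRationalRenewal_one hγ hu, exists_isRationalRenewal_two hγ hu,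
    exists_isRationalRenewal_three hγ hu, exists_isRationalRenewal_four hγ hu]

lemma nuGamma_eq_expMixture {Ω : Type*} [MeasurableSpace Ω] {P : Measure Ω}
    {n k : ℕ} {γ : ℝ} {σ : Fin n → Ω → ℝ} (hσ : ∀ i, AEMeasurable (σ i) P)
    {α : Fin n → ℝ} {a : ℝ} (ha : 0 < a) (hα : ∀ i, α i = a) (hn : n * a = a + k)
    (hlaw : HasLaw (fun ω i => Real.exp (-γ * σ i ω)) (dirichletMeasure α) P)
    {c : Fin k → ℝ} {r : Fin k → ℂ} {i₀ : Fin k}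
    (h : IsRationalRenewal γ c (arithRate γ (a + 1) k) r i₀) :
    nuGamma P γ σ = expMixture c (arithRate γ (a + 1) k) := by
  have hγ := h.pos
  have heq : ∀ t < γ, ∫⁻ s, ENNReal.ofReal (Real.exp (t * s)) ∂(nuGamma P γ σ) =
      ∫⁻ s, ENNReal.ofReal (Real.exp (t * s)) ∂(expMixture c (arithRate γ (a + 1) k)) := by
    intro t ht
    have hx : 0 < 1 + -(t / γ) := by
      rw [← sub_eq_add_neg]; exact sub_pos.2 ((div_lt_one hγ).2 ht)
    rw [lintegral_exp_nuGamma hγ hσ ha hα hlaw ht, h.lintegral_exp ht, sub_eq_add_neg,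
      ← ENNReal.ofReal_natCast n, ← ENNReal.ofReal_mul n.cast_nonneg,
      dirichlet_moment_eq ha hx hn, ← Finset.prod_div_distrib, Finset.prod_range]
    congr 1
    refine Finset.prod_congr rfl fun j _ => ?_
    have h1 : a + 1 + (j : ℕ) + -(t / γ) = (γ * (a + 1 + (j : ℕ)) - t) / γ := by
      field_simp; ring
    rw [arithRate, h1, div_div_eq_mul_div, mul_comm]
  have hprob := h.isProbabilityMeasure
  have hfin : IsFiniteMeasure (nuGamma P γ σ) := by
    refine ⟨?_⟩
    have h0 := heq 0 hγ
    simp only [zero_mul, Real.exp_zero, ENNReal.ofReal_one, lintegral_one] at h0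
    rw [h0]
    exact measure_lt_top _ _
  refine ext_of_lintegral_exp hγ (fun t ht => ?_) heq
  rw [heq t ht, h.lintegral_exp ht]
  exact ENNReal.ofReal_lt_top

end DirichletBranching

theorem mainTheorem7 {Ω : Type*} [MeasurableSpace Ω] (P : Measure Ω) [IsProbabilityMeasure P]
    (n k : ℕ) (hn : 2 ≤ n) (hk : k ∈ ({1, 2, 3, 4} : Set ℕ)) (γ : ℝ) (hγ : 0 < γ)
    (α : Fin n → ℝ) (hα : ∀ i, α i = (k : ℝ) / ((n : ℝ) - 1))
    (σ : Fin n → Ω → ℝ) (hσ : ∀ i, AEMeasurable (σ i) P)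
    (hlaw : HasLaw (fun ω i => Real.exp (-γ * σ i ω)) (DirichletBranching.dirichletMeasure α) P) :
    -- the Fourier transform is given by a convergent integral, is analytic, and omits the value 1
    (∀ w : ℂ, 0 < w.re → w.re ≤ γ →
      Integrable (fun s : ℝ => Complex.exp (w * (s : ℂ))) (DirichletBranching.nuGamma P γ σ)) ∧
    AnalyticOnNhd ℂ (DirichletBranching.fourierTransform (DirichletBranching.nuGamma P γ σ))
      {w : ℂ | 0 < w.re ∧ w.re ≤ γ} ∧
    (∀ w : ℂ, 0 < w.re → w.re ≤ γ →
      DirichletBranching.fourierTransform (DirichletBranching.nuGamma P γ σ) w ≠ 1) ∧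
    -- the moments and the renewal function are well defined
    Integrable (fun s : ℝ => s) (DirichletBranching.nuGamma P γ σ) ∧
    Integrable (fun s : ℝ => s ^ 2) (DirichletBranching.nuGamma P γ σ) ∧
    0 < DirichletBranching.mu (DirichletBranching.nuGamma P γ σ) 1 ∧
    (∀ t : ℝ,
      DirichletBranching.renewalMeasure (DirichletBranching.nuGamma P γ σ) (Set.Iic t) < ⊤) ∧
    -- the exponential rate of convergence
    (fun t : ℝ => DirichletBranching.renewalError (DirichletBranching.nuGamma P γ σ) t -
        DirichletBranching.mu (DirichletBranching.nuGamma P γ σ) 2 /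
          (2 * DirichletBranching.mu (DirichletBranching.nuGamma P γ σ) 1 ^ 2))
      =O[atTop] (fun t : ℝ => Real.exp (-γ * t)) := by
  have hk0 : 0 < (k : ℝ) := by
    rcases hk with rfl | rfl | rfl | rfl <;> norm_num
  have hn1 : 0 < (n : ℝ) - 1 := by
    have : (2 : ℝ) ≤ n := by exact_mod_cast hn
    linarith
  have ha : 0 < (k : ℝ) / ((n : ℝ) - 1) := div_pos hk0 hn1
  -- The identity `n a = a + k` that makes the transform rational.
  have hna : n * ((k : ℝ) / ((n : ℝ) - 1)) = (k : ℝ) / ((n : ℝ) - 1) + k := by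
    field_simp; ring
  obtain ⟨c, r, i₀, h⟩ := DirichletBranching.exists_isRationalRenewal hγ
    (u := (k : ℝ) / ((n : ℝ) - 1) + 1) (by linarith) hk
  have := h.isProbabilityMeasure
  rw [DirichletBranching.nuGamma_eq_expMixture hσ ha hα hna hlaw h]
  exact ⟨fun w _ hw => h.integrable_exp fun j => hw.trans_lt (h.lt_rate j),
    h.analyticOnNhd_fourierTransform, fun w hw hw' => h.fourierTransform_ne_one hw hw',
    by simpa using h.integrable_pow 1, h.integrable_pow 2, h.mu_one_pos,
    DirichletBranching.renewalMeasure_Iic_lt_top _ h.lintegral_exp_neg_lt_one,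
    h.isBigO_renewalError⟩
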